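/- **Setting.** Let $X,U,Y$ be finite-dimensional real Hilbert spaces, $\Theta$ a set and $\theta\in\Theta$ fixed. Let $K:X\to U$ be linear with adjoint $K^*$, let $\tau,\xi>0$ and $\zeta\in\mathbb R$, and let $H:X\times Y\times\Theta\to(-\infty,+\infty]$, $G:U\times Y\times\Theta\to(-\infty,+\infty]$ be such that $x\mapsto H(x,y,\theta)$ and $u\mapsto G(u,y,\theta)$ are proper, closed and convex for every $y\in Y$. Write $\mathrm{Prox}_h(x)=\operatorname{argmin}_z\ \tfrac12\|z-x\|^2+h(z)$ and $G^*(u,y,\theta)=\sup_z\ \langle z,u\rangle-G(z,y,\theta)$, and let $\mathrm{Prox}_{\xi H}(x,y,\theta)$ and $\mathrm{Prox}_{\tau G^*}(u,y,\theta)$ be the proximity operators of $\xi H(\cdot,y,\theta)$ and $\tau G^*(\cdot,y,\theta)$ at $x$ and $u$. The Chambolle–Pock primal–dual algorithm for minimizing $x\mapsto H(x,y,\theta)+G(Kx,y,\theta)$ produces, from an initial state $a^{(0)}(y,\theta)$, the states $a^{(\ell)}=(x^{(\ell)},\tilde x^{(\ell)},u^{(\ell)})$ (functions of $(y,\theta)$),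 $a^{(\ell+1)}=\psi(a^{(\ell)},y,\theta)$, by $$u^{(\ell+1)}=\mathrm{Prox}_{\tau G^*}(U^{(\ell)},y,\theta),\quad U^{(\ell)}=u^{(\ell)}+\tau K\tilde x^{(\ell)},$$ $$x^{(\ell+1)}=\mathrm{Prox}_{\xi H}(X^{(\ell)},y,\theta),\quad X^{(\ell)}=x^{(\ell)}-\xi K^*u^{(\ell+1)},$$ $$\tilde x^{(\ell+1)}=x^{(\ell+1)}+\zeta\,(x^{(\ell+1)}-x^{(\ell)}),$$ and $x^{(\ell)}=\gamma(a^{(\ell)})$ where $\gamma(x,\tilde x,u)=x$. Assume that $y\mapsto a^{(0)}(y,\theta)$ is Lipschitz and that $y\mapsto\psi(a,y,\theta)$ is Lipschitz with a constant that does not depend on $a$. For a map $f$ of two or more arguments, a *version of the Jacobian of $f$ in one of its arguments* is a field of linear maps $J$, indexed by all the arguments, such that, for all values of the other arguments, $J$ is a weak Jacobian of the corresponding partial map (both are locally integrable and integration by parts against $C^1_c$ functions holds), and $J$ equals the classical Jacobian of that partial map wherever that map is classically differentiable. **Claim.** For every $\ell\ge 0$ the maps $y\mapsto a^{(\ell)},u^{(\ell)},x^{(\ell)},\tilde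 x^{(\ell)}$ are weakly differentiable. Moreover there are versions $\mathcal G_u,\mathcal G_y$ of the Jacobians of $\mathrm{Prox}_{\tau G^*}(u,y,\theta)$ in $u$ and in $y$, versions $\mathcal H_x,\mathcal H_y$ of the Jacobians of $\mathrm{Prox}_{\xi H}(x,y,\theta)$ in $x$ and in $y$, and versions $\Psi_a,\Psi_y$ of the Jacobians of $\psi(a,y,\theta)$ in $a$ and in $y$, such that the following holds for any choice of the weak Jacobians of the iterates. For Lebesgue-almost every $y\in Y$, for all $\ell\ge0$ and all $\delta\in Y$, let $\mathcal D_a^{(\ell)},\mathcal D_u^{(\ell)},\mathcal D_x^{(\ell)},\mathcal D_{\tilde x}^{(\ell)}$ be the weak directional derivatives of $a^{(\ell)},u^{(\ell)},x^{(\ell)},\tilde x^{(\ell)}$ with respect to $y$ at $y$ in the direction $\delta$, let $\mathcal G_u^{(\ell)},\mathcal G_y^{(\ell)}$ be the values of $\mathcal G_u,\mathcal G_y$ at $(U^{(\ell)},y)$, $\mathcal H_x^{(\ell)},\mathcal H_y^{(\ell)}$ those of $\mathcal H_x,\mathcal H_y$ at $(X^{(\ell)},y)$, and $\Psi_a^{(\ell)},\Psi_y^{(\ell)}$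 those of $\Psi_a,\Psi_y$ at $(a^{(\ell)},y)$. Then $\mathcal D_a^{(\ell)}=(\mathcal D_x^{(\ell)},\mathcal D_{\tilde x}^{(\ell)},\mathcal D_u^{(\ell)})$, $\mathcal D_x^{(\ell)}=\gamma'(a^{(\ell)})[\mathcal D_a^{(\ell)}]$, $\mathcal D_a^{(\ell+1)}=\Psi_a^{(\ell)}(\mathcal D_a^{(\ell)})+\Psi_y^{(\ell)}(\delta)$, and explicitly $$\mathcal D_u^{(\ell+1)}=\mathcal G_u^{(\ell)}(\mathcal D_U^{(\ell)})+\mathcal G_y^{(\ell)}(\delta),\quad \mathcal D_U^{(\ell)}=\mathcal D_u^{(\ell)}+\tau K\mathcal D_{\tilde x}^{(\ell)},$$ $$\mathcal D_x^{(\ell+1)}=\mathcal H_x^{(\ell)}(\mathcal D_X^{(\ell)})+\mathcal H_y^{(\ell)}(\delta),\quad \mathcal D_X^{(\ell)}=\mathcal D_x^{(\ell)}-\xi K^*\mathcal D_u^{(\ell+1)},$$ $$\mathcal D_{\tilde x}^{(\ell+1)}=\mathcal D_x^{(\ell+1)}+\zeta\,(\mathcal D_x^{(\ell+1)}-\mathcal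 D_x^{(\ell)}).$$ In addition, the right-hand sides $\mathcal G_u^{(\ell)}(\mathcal D_U^{(\ell)})+\mathcal G_y^{(\ell)}(\delta)$, $\mathcal H_x^{(\ell)}(\mathcal D_X^{(\ell)})+\mathcal H_y^{(\ell)}(\delta)$ and $\Psi_a^{(\ell)}(\mathcal D_a^{(\ell)})+\Psi_y^{(\ell)}(\delta)$ are the (two-sided) directional derivatives, in the ordinary sense, of $(u,y)\mapsto\mathrm{Prox}_{\tau G^*}(u,y,\theta)$ at $(U^{(\ell)},y)$ along $(\mathcal D_U^{(\ell)},\delta)$, of $(x,y)\mapsto\mathrm{Prox}_{\xi H}(x,y,\theta)$ at $(X^{(\ell)},y)$ along $(\mathcal D_X^{(\ell)},\delta)$, and of $(a,y)\mapsto\psi(a,y,\theta)$ at $(a^{(\ell)},y)$ along $(\mathcal D_a^{(\ell)},\delta)$. -/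

import Mathlib

open MeasureTheory

noncomputable section

/-! Weak derivatives -/

/-- `Df` is a weak Jacobian of `f : E → F` on the whole space `E`: both are locally integrable, and
integration by parts holds in every direction against all compactly supported `C¹` functions. -/
def HasWeakJacobian {E F : Type*} [NormedAddCommGroup E] [NormedSpace ℝ E] [MeasureSpace E]
    [NormedAddCommGroup F] [NormedSpace ℝ F] (f : E → F) (Df : E → E →L[ℝ] F) : Prop :=
  LocallyIntegrable f (volume : Measure E) ∧ LocallyIntegrable Df (volume : Measure E) ∧
    ∀ φ : E → ℝ, ContDiff ℝ 1 φ → HasCompactSupport φ → ∀ v : E,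
      ∫ a, φ a • Df a v = -∫ a, fderiv ℝ φ a v • f a

/-- `f` is weakly differentiable. -/
def WeaklyDifferentiable {E F : Type*} [NormedAddCommGroup E] [NormedSpace ℝ E] [MeasureSpace E]
    [NormedAddCommGroup F] [NormedSpace ℝ F] (f : E → F) : Prop :=
  ∃ Df : E → E →L[ℝ] F, HasWeakJacobian f Df

/-- `J u y` is a version of the Jacobian of the map `F` with respect to its first argument `u`:
for every `y` it is a weak Jacobian of `F (·, y)`, and it takes the classical value at every point
at which `F (·, y)` is differentiable. -/
def IsJacobianFst {E Y F : Type*} [NormedAddCommGroup E] [NormedSpace ℝ E] [MeasureSpace E]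
    [NormedAddCommGroup F] [NormedSpace ℝ F] (f : E → Y → F) (J : E → Y → E →L[ℝ] F) : Prop :=
  ∀ y : Y, HasWeakJacobian (fun u => f u y) (fun u => J u y) ∧
    ∀ u : E, DifferentiableAt ℝ (fun u' => f u' y) u → J u y = fderiv ℝ (fun u' => f u' y) u

/-- The same with respect to the second argument `y`. -/
def IsJacobianSnd {E Y F : Type*} [NormedAddCommGroup Y] [NormedSpace ℝ Y] [MeasureSpace Y]
    [NormedAddCommGroup F] [NormedSpace ℝ F] (f : E → Y → F) (J : E → Y → Y →L[ℝ] F) : Prop :=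
  ∀ u : E, HasWeakJacobian (fun y => f u y) (fun y => J u y) ∧
    ∀ y : Y, DifferentiableAt ℝ (fun y' => f u y') y → J u y = fderiv ℝ (fun y' => f u y') y

/-! Convex analysis -/

/-- Proper, closed (lower semicontinuous) and convex (convex epigraph) extended-real function. -/
structure ProperClosedConvex {X : Type*} [NormedAddCommGroup X] [NormedSpace ℝ X]
    (h : X → EReal) : Prop where
  ne_bot : ∀ x, h x ≠ ⊥
  exists_ne_top : ∃ x, h x ≠ ⊤
  closed : LowerSemicontinuous h
  convex : Convex ℝ {p : X × ℝ | h p.1 ≤ (p.2 : EReal)}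

/-- `p` minimizes `z ↦ ‖z - x‖² / 2 + h z`. -/
def IsProx {X : Type*} [NormedAddCommGroup X] (h : X → EReal) (x p : X) : Prop :=
  ∀ z : X, ((1 / 2 * ‖p - x‖ ^ 2 : ℝ) : EReal) + h p ≤ ((1 / 2 * ‖z - x‖ ^ 2 : ℝ) : EReal) + h z

/-- The proximity operator: the minimizer of `z ↦ ‖z - x‖² / 2 + h z`
(it exists and is unique for proper closed convex `h` on a Hilbert space). -/
def prox {X : Type*} [NormedAddCommGroup X] (h : X → EReal) (x : X) : X :=
  Classical.epsilon (IsProx h x)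

/-- The Legendre-Fenchel conjugate. -/
def conjugate {X : Type*} [NormedAddCommGroup X] [InnerProductSpace ℝ X] (h : X → EReal) :
    X → EReal :=
  fun u => ⨆ z : X, ((inner ℝ z u : ℝ) : EReal) - h z

/-! The primal-dual algorithm -/

/-- The data of the primal-dual algorithm for minimizing `x ↦ H(x, y, θ) + G(K x, y, θ)`:
the functions, the linear operator, the step sizes `τ`, `ξ` and the relaxation parameter `ζ`. -/
structure CPData (X U Y Θ : Type*) [NormedAddCommGroup X] [InnerProductSpace ℝ X]
    [NormedAddCommGroup U] [InnerProductSpace ℝ U] where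
  H : X → Y → Θ → EReal
  G : U → Y → Θ → EReal
  K : X →ₗ[ℝ] U
  τ : ℝ
  ξ : ℝ
  ζ : ℝ

namespace CPData

variable {X U Y Θ : Type*} [NormedAddCommGroup X] [InnerProductSpace ℝ X]
  [NormedAddCommGroup U] [InnerProductSpace ℝ U]

/-- `(x, y, θ) ↦ Prox_{ξ H}(x, y, θ)`. -/
def proxH (D : CPData X U Y Θ) (x : X) (y : Y) (θ : Θ) : X :=
  prox (fun z => (D.ξ : EReal) * D.H z y θ) x

/-- `(u, y, θ) ↦ Prox_{τ G*}(u, y, θ)`. -/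
def proxGstar (D : CPData X U Y Θ) (u : U) (y : Y) (θ : Θ) : U :=
  prox (fun w => (D.τ : EReal) * conjugate (fun z => D.G z y θ) w) u

variable [FiniteDimensional ℝ X] [FiniteDimensional ℝ U]

/-- One iteration, acting on the state `a = (x, x̃, u)`. -/
def ψ (D : CPData X U Y Θ) (a : X × X × U) (y : Y) (θ : Θ) : X × X × U :=
  let u' := D.proxGstar (a.2.2 + D.τ • D.K a.2.1) y θ
  let x' := D.proxH (a.1 - D.ξ • LinearMap.adjoint D.K u') y θ
  (x', x' + D.ζ • (x' - a.1), u')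

/-- The map extracting the current estimate `x` from the state `a = (x, x̃, u)`. -/
def γ (a : X × X × U) : X := a.1

/-- The states `a ℓ`, started at `a₀ y θ`. -/
def a (D : CPData X U Y Θ) (a₀ : Y → Θ → X × X × U) : ℕ → Y → Θ → X × X × U
  | 0, y, θ => a₀ y θ
  | ℓ + 1, y, θ => D.ψ (D.a a₀ ℓ y θ) y θ

/-- The iterate `x ℓ`. -/
def x (D : CPData X U Y Θ) (a₀ : Y → Θ → X × X × U) (ℓ : ℕ) (y : Y) (θ : Θ) : X :=
  γ (D.a a₀ ℓ y θ)

/-- The iterate `x̃ ℓ`. -/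
def xt (D : CPData X U Y Θ) (a₀ : Y → Θ → X × X × U) (ℓ : ℕ) (y : Y) (θ : Θ) : X :=
  (D.a a₀ ℓ y θ).2.1

/-- The dual iterate `u ℓ`. -/
def u (D : CPData X U Y Θ) (a₀ : Y → Θ → X × X × U) (ℓ : ℕ) (y : Y) (θ : Θ) : U :=
  (D.a a₀ ℓ y θ).2.2

/-- `U ℓ = u ℓ + τ K (x̃ ℓ)`. -/
def argU (D : CPData X U Y Θ) (a₀ : Y → Θ → X × X × U) (ℓ : ℕ) (y : Y) (θ : Θ) : U :=
  D.u a₀ ℓ y θ + D.τ • D.K (D.xt a₀ ℓ y θ)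

/-- `X ℓ = x ℓ - ξ K* (u (ℓ + 1))`. -/
def argX (D : CPData X U Y Θ) (a₀ : Y → Θ → X × X × U) (ℓ : ℕ) (y : Y) (θ : Θ) : X :=
  D.x a₀ ℓ y θ - D.ξ • LinearMap.adjoint D.K (D.u a₀ (ℓ + 1) y θ)

end CPData

end

open Filter Topology

/-! Proximity operators of proper closed convex functions -/


/-! Proximity operators are nonexpansive in their first argument, and the uniform Lipschitz bound on
`ψ` passes to the dependence of both of them on `y`. They are therefore jointly Lipschitz, every
iterate is Lipschitz in `y`, and by Rademacher's theorem any weak Jacobian of an iterate is almost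
everywhere its classical derivative.

The difficulty is the chain rule for `y ↦ f (g y) y` with `f` Lipschitz: the graph of `g` may lie
inside the null set where `f` is not differentiable. Two cases are separated at a point of the
graph. If both partial derivatives exist, their values are forced, and the chain rule holds for
almost every `y` by a density-point argument, without joint differentiability
(`ae_fderiv_comp_graph_eq`). If one is missing, its value is free there and can be defined so that
the chain rule holds (`exists_partial_derivatives_at`). One choice serves all iterates, because at
almost every point where two graphs meet they have the same derivative (`ae_fderiv_eq_of_eq`).
Finally, the graph is tangent to its tangent line and `f` is Lipschitz, so the derivative along the
graph is an ordinary directional derivative (`hasLineDerivAt_graph`). -/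

theorem EReal.exists_coe_eq {a : EReal} (hb : a ≠ ⊥) (ht : a ≠ ⊤) : ∃ r : ℝ, a = r :=
  ⟨a.toReal, (EReal.coe_toReal ht hb).symm⟩

section Prox

variable {E : Type*} [NormedAddCommGroup E] [InnerProductSpace ℝ E]

/-- Scaling by a positive real preserves proper closed convex functions. -/
theorem ProperClosedConvex.const_mul {h : E → EReal} (hh : ProperClosedConvex h) {c : ℝ}
    (hc : 0 < c) : ProperClosedConvex fun x => (c : EReal) * h x := by
  have key : ∀ (a : EReal) (r : ℝ), a ≠ ⊥ → ((c : EReal) * a ≤ r ↔ a ≤ (c⁻¹ * r : ℝ)) := by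
    intro a r ha
    induction a with
    | bot => exact absurd rfl ha
    | top => simp [EReal.coe_mul_top_of_pos hc, -EReal.coe_mul]
    | coe a =>
      rw [← EReal.coe_mul, EReal.coe_le_coe_iff, EReal.coe_le_coe_iff, le_inv_mul_iff₀ hc]
  refine ⟨fun x => ?_, ?_, ?_, ?_⟩
  · have := hh.ne_bot x
    generalize h x = a at this
    induction a with
    | bot => exact absurd rfl this
    | top => simp [EReal.coe_mul_top_of_pos hc]
    | coe a => rw [← EReal.coe_mul]; exact EReal.coe_ne_bot _
  · obtain ⟨x, hx⟩ := hh.exists_ne_top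
    obtain ⟨r, hr⟩ := EReal.exists_coe_eq (hh.ne_bot x) hx
    refine ⟨x, ?_⟩
    simp only [hr, ← EReal.coe_mul]
    exact EReal.coe_ne_top _
  · refine Continuous.comp_lowerSemicontinuous ?_ hh.closed ?_
    · rw [continuous_iff_continuousAt]
      intro a
      exact EReal.Tendsto.const_mul tendsto_id (Or.inl (EReal.coe_ne_bot _))
        (Or.inl (EReal.coe_ne_top _))
    · exact fun a b hab => mul_le_mul_of_nonneg_left hab (EReal.coe_nonneg.2 hc.le)
  · intro p hp q hq s t hs ht hst
    simp only [Set.mem_ofPred_eq] at hp hq ⊢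
    rw [key _ _ (hh.ne_bot _)] at hp hq ⊢
    have := @hh.convex (p.1, c⁻¹ * p.2) hp (q.1, c⁻¹ * q.2) hq s t hs ht hst
    simp only [Set.mem_ofPred_eq, Prod.smul_fst, Prod.fst_add, Prod.snd_add, Prod.smul_snd,
      smul_eq_mul] at this ⊢
    convert this using 2
    ring

/-- Convexity of the epigraph on a segment, with real majorants so that no extended arithmetic is
needed. -/
theorem ProperClosedConvex.le_of_coe {h : E → EReal} (hh : ProperClosedConvex h) {x z : E}
    {a b : ℝ} (hx : h x ≤ a) (hz : h z ≤ b) {t : ℝ} (h0 : 0 ≤ t) (h1 : t ≤ 1) :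
    h (x + t • (z - x)) ≤ ((a + t * (b - a) : ℝ) : EReal) := by
  have := @hh.convex (x, a) hx (z, b) hz (1 - t) t (by linarith) h0 (by ring)
  simp only [Set.mem_ofPred_eq, Prod.smul_fst, Prod.fst_add, Prod.snd_add, Prod.smul_snd,
      smul_eq_mul] at this
  convert this using 2
  · module
  · ring

/-- A proper closed convex function decreases at most linearly. -/
theorem ProperClosedConvex.exists_linear_lower_bound {h : E → EReal} (hh : ProperClosedConvex h)
    {x : E} {a : ℝ} (hx : h x = a) :
    ∃ r : ℝ, 0 < r ∧ ∀ z, r ≤ ‖z - x‖ → ((a - ‖z - x‖ / r : ℝ) : EReal) ≤ h z := by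
  have hlt : ((a - 1 : ℝ) : EReal) < h x := by
    rw [hx]; exact EReal.coe_lt_coe_iff.2 (by linarith)
  have hlsc := hh.closed x _ hlt
  obtain ⟨r, hr, hball⟩ := Metric.eventually_nhds_iff_ball.1 hlsc
  refine ⟨r / 2, by positivity, fun z hz => ?_⟩
  by_contra! hlt
  have hpos : 0 < ‖z - x‖ := by linarith
  obtain ⟨b, hb⟩ := EReal.exists_coe_eq (hh.ne_bot z) hlt.ne_top
  rw [hb, EReal.coe_lt_coe_iff] at hlt
  -- This `t` puts the point of the segment at distance `r / 2` from `x`, inside the ball where `h >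
  -- a - 1`; too small a value at `z` would force a value below `a - 1` there.
  set t := (r / 2) / ‖z - x‖ with ht
  have ht0 : 0 < t := by positivity
  have h1 := hh.le_of_coe hx.le hb.le ht0.le ((div_le_one hpos).2 hz)
  have hmem : x + t • (z - x) ∈ Metric.ball x r := by
    rw [mem_ball_iff_norm, add_sub_cancel_left, norm_smul, Real.norm_of_nonneg ht0.le, ht,
      div_mul_cancel₀ _ hpos.ne']
    linarith
  have h2 := (hball _ hmem).trans_le h1
  rw [EReal.coe_lt_coe_iff] at h2
  have h3 : t * (b - a) < t * (-(‖z - x‖ / (r / 2))) := by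
    apply mul_lt_mul_of_pos_left _ ht0
    linarith
  have h4 : t * (-(‖z - x‖ / (r / 2))) = -1 := by
    rw [ht]; field_simp
  linarith

/-- Existence of the proximal point. -/
theorem ProperClosedConvex.exists_isProx [FiniteDimensional ℝ E] {h : E → EReal}
    (hh : ProperClosedConvex h) (x : E) : ∃ p, IsProx h x p := by
  obtain ⟨z₀, hz₀⟩ := hh.exists_ne_top
  obtain ⟨s, hs⟩ := EReal.exists_coe_eq (hh.ne_bot z₀) hz₀
  obtain ⟨r, hr, hlow⟩ := hh.exists_linear_lower_bound hs
  -- Beyond distance `2 * ‖z₀ - x‖ + 2 / r` the quadratic term beats the linear decrease of `h`; the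
  -- extra `r` makes the linear lower bound applicable. A minimizer on the ball is then global.
  set R : ℝ := 2 * ‖z₀ - x‖ + 2 / r + r with hR
  have hRpos : 0 < R := by positivity
  have hlsc : LowerSemicontinuous fun z => ((1 / 2 * ‖z - x‖ ^ 2 : ℝ) : EReal) + h z := by
    refine LowerSemicontinuous.add' ?_ hh.closed fun z => ?_
    · have : Continuous fun z : E => ((1 / 2 * ‖z - x‖ ^ 2 : ℝ) : EReal) :=
        continuous_coe_real_ereal.comp (by fun_prop)
      exact this.lowerSemicontinuous
    · exact EReal.continuousAt_add (Or.inl (EReal.coe_ne_top _)) (Or.inl (EReal.coe_ne_bot _))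
  obtain ⟨p, -, hp⟩ := (hlsc.lowerSemicontinuousOn (Metric.closedBall z₀ R)).exists_isMinOn
    ⟨z₀, Metric.mem_closedBall_self hRpos.le⟩ (isCompact_closedBall z₀ R)
  refine ⟨p, fun z => ?_⟩
  by_cases hz : z ∈ Metric.closedBall z₀ R
  · exact hp hz
  refine (hp (Metric.mem_closedBall_self hRpos.le)).trans ?_
  rw [mem_closedBall_iff_norm, not_le] at hz
  have h2r : 0 < 2 / r := by positivity
  have hc := norm_nonneg (z₀ - x)
  refine le_trans ?_ (add_le_add le_rfl (hlow z (by linarith)))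
  simp only [hs, ← EReal.coe_add, EReal.coe_le_coe_iff]
  have htri : ‖z - z₀‖ - ‖z₀ - x‖ ≤ ‖z - x‖ := by
    have : z - x = (z - z₀) + (z₀ - x) := by abel
    rw [this]
    have := norm_sub_le_norm_add (z - z₀) (z₀ - x)
    linarith
  have hsq : (‖z - z₀‖ - ‖z₀ - x‖) ^ 2 ≤ ‖z - x‖ ^ 2 :=
    pow_le_pow_left₀ (by linarith) htri 2
  have hdiv : ‖z - z₀‖ / r = ‖z - z₀‖ * (2 / r) / 2 := by ring
  have hmul : 0 ≤ ‖z - z₀‖ * (‖z - z₀‖ - 2 * ‖z₀ - x‖ - 2 / r) :=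
    mul_nonneg (norm_nonneg _) (by linarith)
  rw [hdiv]
  nlinarith

theorem IsProx.ne_top {h : E → EReal} (hh : ProperClosedConvex h) {x p : E} (hp : IsProx h x p) :
    h p ≠ ⊤ := by
  obtain ⟨z₀, hz₀⟩ := hh.exists_ne_top
  obtain ⟨s, hs⟩ := EReal.exists_coe_eq (hh.ne_bot z₀) hz₀
  intro htop
  have := hp z₀
  rw [htop, hs, EReal.coe_add_top, ← EReal.coe_add, top_le_iff] at this
  exact EReal.coe_ne_top _ this

/-- The variational inequality characterizing the proximal point: `x - p` is a subgradient
at `p`. -/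
theorem IsProx.inner_le {h : E → EReal} (hh : ProperClosedConvex h) {x p : E} (hp : IsProx h x p)
    {s : ℝ} (hs : h p = s) {z : E} {b : ℝ} (hb : h z = b) : s + inner ℝ (x - p) (z - p) ≤ b := by
  -- Compare `p` with `p + t • (z - p)` and divide by `t`; the error term vanishes as `t → 0`.
  have key : ∀ t : ℝ, 0 < t → t ≤ 1 →
      s + inner ℝ (x - p) (z - p) ≤ b + t * (1 / 2 * ‖z - p‖ ^ 2) := by
    intro t h0 h1
    have h2 := (hp (p + t • (z - p))).trans
      (add_le_add le_rfl (hh.le_of_coe hs.le hb.le h0.le h1))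
    rw [hs, ← EReal.coe_add, ← EReal.coe_add, EReal.coe_le_coe_iff] at h2
    have h3 : ‖p + t • (z - p) - x‖ ^ 2
        = ‖p - x‖ ^ 2 - 2 * t * inner ℝ (x - p) (z - p) + t ^ 2 * ‖z - p‖ ^ 2 := by
      rw [show p + t • (z - p) - x = (p - x) + t • (z - p) by abel, norm_add_sq_real, norm_smul,
        inner_smul_right, ← neg_sub x p, inner_neg_left, Real.norm_of_nonneg h0.le]
      ring
    rw [h3] at h2
    have h4 : t * (s + inner ℝ (x - p) (z - p)) ≤ t * (b + t * (1 / 2 * ‖z - p‖ ^ 2)) := by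
      nlinarith
    exact le_of_mul_le_mul_left h4 h0
  have hlim : Tendsto (fun t : ℝ => b + t * (1 / 2 * ‖z - p‖ ^ 2)) (𝓝[>] 0) (𝓝 b) := by
    have : Continuous fun t : ℝ => b + t * (1 / 2 * ‖z - p‖ ^ 2) := by fun_prop
    simpa using (this.tendsto 0).mono_left nhdsWithin_le_nhds
  refine ge_of_tendsto hlim ?_
  filter_upwards [Ioo_mem_nhdsGT (zero_lt_one' ℝ)] with t ht using key t ht.1 ht.2.le

theorem ProperClosedConvex.isProx_prox [FiniteDimensional ℝ E] {h : E → EReal}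
    (hh : ProperClosedConvex h) (x : E) : IsProx h x (prox h x) :=
  Classical.epsilon_spec (hh.exists_isProx x)

/-- The proximity operator is nonexpansive. -/
theorem ProperClosedConvex.lipschitzWith_prox [FiniteDimensional ℝ E] {h : E → EReal}
    (hh : ProperClosedConvex h) : LipschitzWith 1 (prox h) := by
  refine LipschitzWith.of_dist_le_mul fun x y => ?_
  have hx := hh.isProx_prox x
  have hy := hh.isProx_prox y
  generalize prox h x = p at *
  generalize prox h y = q at *
  obtain ⟨s, hs⟩ := EReal.exists_coe_eq (hh.ne_bot p) (hx.ne_top hh)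
  obtain ⟨t, ht⟩ := EReal.exists_coe_eq (hh.ne_bot q) (hy.ne_top hh)
  have h1 := hx.inner_le hh hs ht
  have h2 := hy.inner_le hh ht hs
  rw [NNReal.coe_one, one_mul, dist_eq_norm, dist_eq_norm]
  -- Sum of the two variational inequalities; Cauchy–Schwarz then finishes.
  have h3 : ‖p - q‖ ^ 2 ≤ inner ℝ (x - y) (p - q) := by
    have e1 : inner ℝ (x - p) (q - p) = -inner ℝ (x - p) (p - q) := by
      rw [← inner_neg_right, neg_sub]
    have e2 : inner ℝ (x - y) (p - q)
        = inner ℝ (x - p) (p - q) - inner ℝ (y - q) (p - q) + ‖p - q‖ ^ 2 := by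
      rw [← real_inner_self_eq_norm_sq, ← inner_sub_left, ← inner_add_left]
      congr 1
      abel
    linarith
  have h4 := h3.trans (real_inner_le_norm (x - y) (p - q))
  by_contra! hlt
  have := norm_nonneg (x - y)
  nlinarith

/-- The conjugate of a proper closed convex function is proper closed convex. -/
theorem ProperClosedConvex.conjugate [FiniteDimensional ℝ E] {h : E → EReal}
    (hh : ProperClosedConvex h) : ProperClosedConvex (conjugate h) := by
  refine ⟨fun u => ?_, ?_, ?_, ?_⟩
  · obtain ⟨z, hz⟩ := hh.exists_ne_top
    obtain ⟨s, hs⟩ := EReal.exists_coe_eq (hh.ne_bot z) hz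
    have := le_iSup (fun z : E => ((inner ℝ z u : ℝ) : EReal) - h z) z
    rw [hs, ← EReal.coe_sub] at this
    exact ((EReal.bot_lt_coe _).trans_le this).ne'
  -- With `p` the proximal point of `0`, the vector `0 - p` is a subgradient at `p`, so the
  -- conjugate is finite there.
  · obtain ⟨p, hp⟩ := hh.exists_isProx 0
    obtain ⟨s, hs⟩ := EReal.exists_coe_eq (hh.ne_bot p) (hp.ne_top hh)
    refine ⟨0 - p, ((iSup_le fun z => ?_).trans_lt
      (EReal.coe_lt_top (inner ℝ p (0 - p) - s))).ne⟩
    by_cases hz : h z = ⊤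
    · simp [hz]
    · obtain ⟨b, hb⟩ := EReal.exists_coe_eq (hh.ne_bot z) hz
      have := hp.inner_le hh hs hb
      rw [hb, ← EReal.coe_sub, EReal.coe_le_coe_iff, real_inner_comm (0 - p) z,
        real_inner_comm (0 - p) p]
      rw [inner_sub_right] at this
      linarith
  · refine lowerSemicontinuous_iSup fun z => ?_
    by_cases hz : h z = ⊤
    · simpa [hz] using lowerSemicontinuous_const
    · obtain ⟨b, hb⟩ := EReal.exists_coe_eq (hh.ne_bot z) hz
      simp only [hb, ← EReal.coe_sub]
      have : Continuous fun u : E => ((inner ℝ z u - b : ℝ) : EReal) :=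
        continuous_coe_real_ereal.comp (by fun_prop)
      exact this.lowerSemicontinuous
  · intro p hp q hq s t h0 h1 hst
    simp only [Set.mem_ofPred_eq, _root_.conjugate, iSup_le_iff] at hp hq ⊢
    intro z
    by_cases hz : h z = ⊤
    · simp [hz]
    · obtain ⟨b, hb⟩ := EReal.exists_coe_eq (hh.ne_bot z) hz
      have hp := hp z
      have hq := hq z
      simp only [hb, ← EReal.coe_sub, EReal.coe_le_coe_iff] at hp hq ⊢
      simp only [Prod.smul_fst, Prod.fst_add, Prod.snd_add, Prod.smul_snd, smul_eq_mul,
        inner_add_right, inner_smul_right]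
      have : b = s * b + t * b := by rw [← add_mul, hst, one_mul]
      nlinarith [mul_le_mul_of_nonneg_left hp h0, mul_le_mul_of_nonneg_left hq h1]

end Prox

/-! Weak Jacobians of Lipschitz maps -/

section WeakJacobian

variable {E F : Type*} [NormedAddCommGroup E] [NormedSpace ℝ E] [FiniteDimensional ℝ E]
  [MeasureSpace E] [BorelSpace E] [(volume : Measure E).IsAddHaarMeasure]
  [NormedAddCommGroup F] [NormedSpace ℝ F] [FiniteDimensional ℝ F]

/-- A map that agrees almost everywhere with the classical derivative of a Lipschitz map is a weak
Jacobian. -/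
theorem LipschitzWith.hasWeakJacobian {C : NNReal} {f : E → F} (hf : LipschitzWith C f)
    {Df : E → E →L[ℝ] F} (hDf : Df =ᵐ[volume] fderiv ℝ f) : HasWeakJacobian f Df := by
  have : CompleteSpace F := FiniteDimensional.complete ℝ F
  have hint : LocallyIntegrable (fderiv ℝ f) (volume : Measure E) := by
    borelize (E →L[ℝ] F)
    exact (memLp_top_of_bound (measurable_fderiv ℝ f).aestronglyMeasurable C
      (.of_forall fun x => norm_fderiv_le_of_lipschitz ℝ hf)).locallyIntegrable le_top
  have hfint : LocallyIntegrable f (volume : Measure E) := hf.continuous.locallyIntegrable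
  refine ⟨hfint, hint.congr hDf.symm, fun φ hφ hφc v => ?_⟩
  have h1 : ∫ a, φ a • Df a v = ∫ a, φ a • fderiv ℝ f a v :=
    integral_congr_ae (hDf.mono fun a ha => by simp only [ha])
  have hv : LocallyIntegrable (fun a => fderiv ℝ f a v) (volume : Measure E) := by
    borelize F
    exact (memLp_top_of_bound (measurable_fderiv_apply_const ℝ f v).aestronglyMeasurable (C * ‖v‖)
      (.of_forall fun x => (ContinuousLinearMap.le_opNorm _ _).trans (by
        gcongr
        exact norm_fderiv_le_of_lipschitz ℝ hf))).locallyIntegrable le_top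
  have hi1 : Integrable (fun a => φ a • fderiv ℝ f a v) :=
    hv.integrable_smul_left_of_hasCompactSupport hφ.continuous hφc
  have hi2 : Integrable (fun a => fderiv ℝ φ a v • f a) :=
    hfint.integrable_smul_left_of_hasCompactSupport
      ((hφ.continuous_fderiv one_ne_zero).clm_apply continuous_const)
      (hφc.fderiv_apply ℝ v)
  -- Testing with linear functionals reduces to scalar Lipschitz functions; the scalar formula
  -- differentiates the test function along `-v`, which supplies the sign.
  rw [h1, SeparatingDual.eq_iff_forall_dual_eq (R := ℝ)]
  intro ℓ
  rw [map_neg, ← ContinuousLinearMap.integral_comp_comm _ hi1,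
    ← ContinuousLinearMap.integral_comp_comm _ hi2, ← integral_neg]
  obtain ⟨D, hD⟩ := ContDiff.lipschitzWith_of_hasCompactSupport hφc hφ one_ne_zero
  have h2 := (ℓ.lipschitz.comp hf).integral_lineDeriv_mul_eq (μ := volume) hD hφc v
  have h3 : ∫ a, ℓ (φ a • fderiv ℝ f a v) = ∫ a, lineDeriv ℝ (ℓ ∘ f) a v * φ a := by
    refine integral_congr_ae ?_
    filter_upwards [hf.ae_differentiableAt (μ := volume)] with a ha
    rw [((ℓ.hasFDerivAt.comp a ha.hasFDerivAt).hasLineDerivAt v).lineDeriv]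
    simp [mul_comm]
  rw [h3, h2]
  refine integral_congr_ae (.of_forall fun a => ?_)
  simp only [((hφ.differentiable one_ne_zero a).hasFDerivAt.hasLineDerivAt (-v)).lineDeriv]
  simp

/-- Weak Jacobians of a Lipschitz map agree almost everywhere with its classical derivative. -/
theorem HasWeakJacobian.ae_eq_fderiv {C : NNReal} {f : E → F} (hf : LipschitzWith C f)
    {Df : E → E →L[ℝ] F} (hDf : HasWeakJacobian f Df) : Df =ᵐ[volume] fderiv ℝ f := by
  have hD' := hf.hasWeakJacobian (ae_eq_refl _)
  have : CompleteSpace F := FiniteDimensional.complete ℝ F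
  refine ae_eq_of_integral_contDiff_smul_eq hDf.2.1 hD'.2.1 fun φ hφ hφc => ?_
  have hi := fun {G : E → E →L[ℝ] F} (hG : LocallyIntegrable G (volume : Measure E)) =>
    hG.integrable_smul_left_of_hasCompactSupport hφ.continuous hφc
  ext v
  rw [ContinuousLinearMap.integral_apply (hi hDf.2.1),
    ContinuousLinearMap.integral_apply (hi hD'.2.1)]
  exact (hDf.2.2 φ (hφ.of_le (by simp)) hφc v).trans
    (hD'.2.2 φ (hφ.of_le (by simp)) hφc v).symm

theorem LipschitzWith.weaklyDifferentiable {C : NNReal} {f : E → F} (hf : LipschitzWith C f) :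
    WeaklyDifferentiable f :=
  ⟨_, hf.hasWeakJacobian (ae_eq_refl _)⟩

end WeakJacobian

/-! Differentiation along graphs -/

section Density

variable {E : Type*} [NormedAddCommGroup E] [NormedSpace ℝ E]

/-- Almost every point of an arbitrary set has full tangent cone. -/
theorem ae_tangentConeAt_eq_univ [FiniteDimensional ℝ E] [MeasurableSpace E] [BorelSpace E]
    (μ : Measure E) [μ.IsAddHaarMeasure] (s : Set E) :
    ∀ᵐ x ∂μ, x ∈ s → tangentConeAt ℝ s x = Set.univ := by
  refine ae_imp_of_ae_restrict ?_
  filter_upwards [Besicovitch.ae_tendsto_measure_inter_div μ s] with x hx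
  refine Set.eq_univ_of_forall fun v => ?_
  -- At a density point `x`, arbitrarily small homothetic copies `x + r • B(v, 1/(n+1))` must meet
  -- `s`; the density theorem requires no measurability of `s`.
  have key : ∀ n : ℕ, ∃ (r : ℝ) (w : E), 0 < r ∧ r < 1 / ((n : ℝ) + 1) ∧
      dist w v ≤ 1 / ((n : ℝ) + 1) ∧ x + r • w ∈ s := by
    intro n
    have hn : 0 < 1 / ((n : ℝ) + 1) := Nat.one_div_pos_of_nat
    have hB := Measure.eventually_nonempty_inter_smul_of_density_one μ s x hx
      (Metric.closedBall v (1 / ((n : ℝ) + 1))) measurableSet_closedBall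
      (Metric.measure_closedBall_pos μ v hn).ne'
    obtain ⟨r, ⟨z, hzs, hz⟩, hr⟩ := (hB.and (Ioo_mem_nhdsGT hn)).exists
    obtain ⟨a, ha, b, hb, rfl⟩ := Set.mem_add.1 hz
    obtain ⟨w, hw, rfl⟩ := Set.mem_smul_set.1 hb
    rw [Set.mem_singleton_iff.1 ha] at hzs
    exact ⟨r, w, hr.1, hr.2, hw, hzs⟩
  choose r w hr0 hr1 hw hs using key
  have hrlim : Tendsto r atTop (𝓝 0) :=
    squeeze_zero (fun n => (hr0 n).le) (fun n => (hr1 n).le) tendsto_one_div_add_atTop_nhds_zero_nat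
  have hwlim : Tendsto w atTop (𝓝 v) := tendsto_iff_dist_tendsto_zero.2
    (squeeze_zero (fun n => dist_nonneg) hw tendsto_one_div_add_atTop_nhds_zero_nat)
  refine mem_tangentConeAt_of_seq atTop (fun n => (r n)⁻¹) (fun n => r n • w n) ?_
    (.of_forall hs) ?_
  · simpa using hrlim.smul hwlim
  · simpa [smul_smul, inv_mul_cancel₀ (hr0 _).ne'] using hwlim

/-- A linear map that is small on the increments of a set is small on its tangent cone. -/
theorem norm_apply_le_of_mem_tangentConeAt {F : Type*} [NormedAddCommGroup F] [NormedSpace ℝ F]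
    (M : E →L[ℝ] F) {s : Set E} {x v : E} {ε : ℝ}
    (h : ∀ η > 0, ∀ᶠ z in 𝓝[s] x, ‖M (z - x)‖ ≤ (ε + η) * ‖z - x‖)
    (hv : v ∈ tangentConeAt ℝ s x) : ‖M v‖ ≤ ε * ‖v‖ := by
  obtain ⟨α, l, hl, c, d, hd, hds, hcd⟩ := exists_fun_of_mem_tangentConeAt hv
  have hlim : Tendsto (fun n => x + d n) l (𝓝[s] x) := by
    refine tendsto_nhdsWithin_iff.2 ⟨?_, hds⟩
    simpa using tendsto_const_nhds.add hd
  have key : ∀ η > 0, ‖M v‖ ≤ (ε + η) * ‖v‖ := by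
    intro η hη
    refine le_of_tendsto_of_tendsto ((M.continuous.tendsto v).comp hcd).norm
      (hcd.norm.const_mul (ε + η)) ?_
    filter_upwards [hlim.eventually (h η hη)] with n hn
    simp only [Function.comp_apply, map_smul, norm_smul, add_sub_cancel_left] at hn ⊢
    calc ‖c n‖ * ‖M (d n)‖ ≤ ‖c n‖ * ((ε + η) * ‖d n‖) := by gcongr
      _ = _ := by ring
  have hlim2 : Tendsto (fun η : ℝ => (ε + η) * ‖v‖) (𝓝[>] 0) (𝓝 (ε * ‖v‖)) := by
    have : Continuous fun η : ℝ => (ε + η) * ‖v‖ := by fun_prop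
    simpa using (this.tendsto 0).mono_left nhdsWithin_le_nhds
  exact ge_of_tendsto hlim2 (eventually_mem_nhdsWithin.mono key)

end Density

/-! ### The chain rule along graphs -/

section Graph

variable {E Y F : Type*} [NormedAddCommGroup E] [NormedSpace ℝ E]
  [NormedAddCommGroup Y] [NormedSpace ℝ Y] [NormedAddCommGroup F] [NormedSpace ℝ F]

/-- Along the graph of `g`, at almost every point the chain rule with partial derivatives holds as
soon as all the derivatives in it exist. -/
theorem ae_fderiv_comp_graph_eq [FiniteDimensional ℝ Y] [MeasurableSpace Y] [BorelSpace Y]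
    [FiniteDimensional ℝ F] (μ : Measure Y) [μ.IsAddHaarMeasure] (f : E → Y → F) (g : Y → E) :
    ∀ᵐ y ∂μ, ∀ (p : E →L[ℝ] F) (q : Y →L[ℝ] F) (A : Y →L[ℝ] E) (d : Y →L[ℝ] F),
      HasFDerivAt (fun u => f u y) p (g y) → HasFDerivAt (fun z => f (g y) z) q y →
      HasFDerivAt g A y → HasFDerivAt (fun z => f (g z) z) d y → d = p.comp A + q := by
  let Q := TopologicalSpace.denseSeq (Y →L[ℝ] F)
  -- These countably many sets make the expansion of `f (g y) ·` uniform: a fixed linear map `Q j`,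
  -- a fixed error `1/(m+1)` and a fixed radius `1/(n+1)`.
  let S : ℕ → ℕ → ℕ → Set Y := fun m j n =>
    {y | ‖fderiv ℝ (fun z => f (g y) z) y - Q j‖ ≤ 1 / ((m : ℝ) + 1) ∧
      ∀ k : Y, ‖k‖ < 1 / ((n : ℝ) + 1) →
        ‖f (g y) (y + k) - f (g y) y - Q j k‖ ≤ 1 / ((m : ℝ) + 1) * ‖k‖}
  have hae : ∀ᵐ y ∂μ, ∀ m j n, y ∈ S m j n → tangentConeAt ℝ (S m j n) y = Set.univ := by
    simp only [ae_all_iff]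
    exact fun m j n => ae_tangentConeAt_eq_univ μ _
  filter_upwards [hae] with y hy p q A d hp hq hA hd
  have hsmall : ∀ m : ℕ, ‖d - p.comp A - q‖ ≤ 1 / ((m : ℝ) + 1) + 1 / ((m : ℝ) + 1) := by
    intro m
    have hm : 0 < 1 / ((m : ℝ) + 1) := Nat.one_div_pos_of_nat
    obtain ⟨j, hj⟩ := (TopologicalSpace.denseRange_denseSeq (Y →L[ℝ] F)).exists_dist_lt q
      (half_pos hm)
    rw [dist_eq_norm] at hj
    obtain ⟨r, hr, hball⟩ := Metric.eventually_nhds_iff_ball.1 (hq.isLittleO.def (half_pos hm))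
    obtain ⟨n, hn⟩ := exists_nat_one_div_lt hr
    have hmem : y ∈ S m j n := by
      refine ⟨by rw [hq.fderiv]; linarith, fun k hk => ?_⟩
      have h1 := hball (y + k) (by rw [mem_ball_iff_norm, add_sub_cancel_left]; linarith)
      rw [add_sub_cancel_left] at h1
      have h2 : ‖(q - Q j) k‖ ≤ 1 / ((m : ℝ) + 1) / 2 * ‖k‖ :=
        (ContinuousLinearMap.le_opNorm _ _).trans (by gcongr)
      have h3 : f (g y) (y + k) - f (g y) y - Q j k
          = (f (g y) (y + k) - f (g y) y - q k) + (q - Q j) k := by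
        rw [sub_apply]; abel
      rw [h3]
      refine (norm_add_le _ _).trans ?_
      linarith
    -- This difference is also controlled on `S m j n` by expanding at the base point `g z` from `z`
    -- back to `y`. Hence `d - p.comp A` is close to `Q j` on increments of the set, and so on its
    -- full tangent cone.
    have hR : HasFDerivAt (fun z => f (g z) z - f (g z) y) (d - p.comp A) y :=
      hd.sub (hp.comp y hA)
    have hbound : ‖d - p.comp A - Q j‖ ≤ 1 / ((m : ℝ) + 1) := by
      refine ContinuousLinearMap.opNorm_le_bound _ hm.le fun v => ?_
      refine norm_apply_le_of_mem_tangentConeAt (s := S m j n) (x := y) _ (fun η hη => ?_)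
        (by rw [hy m j n hmem]; trivial)
      have hnear : ∀ᶠ z in 𝓝[S m j n] y, z ∈ Metric.ball y (1 / ((n : ℝ) + 1)) :=
        nhdsWithin_le_nhds (Metric.ball_mem_nhds y Nat.one_div_pos_of_nat)
      filter_upwards [hnear, nhdsWithin_le_nhds (hR.isLittleO.def hη), eventually_mem_nhdsWithin]
        with z hz hzR hzS
      rw [mem_ball_iff_norm, norm_sub_rev] at hz
      have h1 := hzS.2 (y - z) hz
      have hz' : ‖f (g z) z - f (g z) y - (f (g y) y - f (g y) y) - (d - p.comp A) (z - y)‖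
        ≤ η * ‖z - y‖ := hzR
      rw [add_sub_cancel, norm_sub_rev y z] at h1
      have h2 : (d - p.comp A - Q j) (z - y)
          = -(f (g z) z - f (g z) y - (f (g y) y - f (g y) y) - (d - p.comp A) (z - y))
            - (f (g z) y - f (g z) z - Q j (y - z)) := by
        rw [sub_apply (d - p.comp A), ← neg_sub z y, map_neg]
        abel
      rw [h2]
      refine (norm_sub_le _ _).trans ?_
      rw [norm_neg]
      linarith
    have h4 : d - p.comp A - q = (d - p.comp A - Q j) - (q - Q j) := by abel
    rw [h4]
    refine (norm_sub_le _ _).trans ?_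
    linarith
  have hlim : Tendsto (fun m : ℕ => 1 / ((m : ℝ) + 1) + 1 / ((m : ℝ) + 1)) atTop (𝓝 0) := by
    simpa using tendsto_one_div_add_atTop_nhds_zero_nat.add
      (tendsto_one_div_add_atTop_nhds_zero_nat (𝕜 := ℝ))
  have hzero : ‖d - p.comp A - q‖ ≤ 0 := ge_of_tendsto' hlim hsmall
  rw [norm_le_zero_iff, sub_sub, sub_eq_zero] at hzero
  exact hzero

/-- Two maps have the same derivative at almost every point where they agree. -/
theorem ae_fderiv_eq_of_eq [FiniteDimensional ℝ Y] [MeasurableSpace Y] [BorelSpace Y]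
    (μ : Measure Y) [μ.IsAddHaarMeasure] (g₁ g₂ : Y → E) :
    ∀ᵐ y ∂μ, g₁ y = g₂ y → DifferentiableAt ℝ g₁ y → DifferentiableAt ℝ g₂ y →
      fderiv ℝ g₁ y = fderiv ℝ g₂ y := by
  filter_upwards [ae_tangentConeAt_eq_univ μ {y | g₁ y = g₂ y}] with y hy heq h₁ h₂
  -- A full tangent cone means that the values on the coincidence set determine the derivative.
  have hu : UniqueDiffWithinAt ℝ {y | g₁ y = g₂ y} y :=
    ⟨by rw [hy heq]; simp, subset_closure heq⟩
  exact hu.eq h₁.hasFDerivAt.hasFDerivWithinAt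
    (h₂.hasFDerivAt.hasFDerivWithinAt.congr (fun z hz => hz) heq)

/-- A Lipschitz map has line derivatives along the tangent directions of a graph on which it is
differentiable. -/
theorem hasLineDerivAt_graph {C : NNReal} {f : E → Y → F}
    (hf : LipschitzWith C fun p : E × Y => f p.1 p.2) {g : Y → E} {y : Y} {A : Y →L[ℝ] E}
    {d : Y →L[ℝ] F} (hA : HasFDerivAt g A y) (hd : HasFDerivAt (fun z => f (g z) z) d y) (δ : Y) :
    HasLineDerivAt ℝ (fun p : E × Y => f p.1 p.2) (d δ) (g y, y) (A δ, δ) := by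
  -- The error made by following the line instead of the graph; it is `o(t)` since `f` is Lipschitz
  -- and `g` differentiable.
  let e : ℝ → F := fun t =>
    f (g y + t • A δ) (y + t • δ) - f (g (y + t • δ)) (y + t • δ)
  have he : HasDerivAt e 0 0 := by
    refine HasDerivAt.of_isLittleO (Asymptotics.IsBigO.trans_isLittleO
      (Asymptotics.IsBigO.of_bound C (.of_forall fun t => ?_)) (hA.hasLineDerivAt δ).isLittleO)
    have h1 := hf.dist_le_mul (g y + t • A δ, y + t • δ) (g (y + t • δ), y + t • δ)
    rw [Prod.dist_eq, dist_self, max_eq_left dist_nonneg, dist_eq_norm, dist_comm,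
      dist_eq_norm] at h1
    have h2 : g (y + t • δ) - g (y + (0 : ℝ) • δ) - (t - 0) • A δ
        = g (y + t • δ) - (g y + t • A δ) := by
      simp [sub_sub]
    rw [h2]
    simpa [e] using h1
  have h := (hd.hasLineDerivAt δ).add he
  rw [add_zero] at h
  refine HasDerivAt.congr_of_eventuallyEq h (.of_forall fun t => ?_)
  simp [e]

/-- A linear map factors through another one whose kernel is smaller. -/
theorem exists_comp_eq_of_forall_eq_zero [FiniteDimensional ℝ E] (A : Y →L[ℝ] E)
    (B : Y →L[ℝ] F) (h : ∀ v, A v = 0 → B v = 0) : ∃ P : E →L[ℝ] F, ∀ v, P (A v) = B v := by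
  -- `P` extends `B ∘ σ` from the range of `A`; the kernel condition makes the choice of preimage
  -- `σ` irrelevant.
  obtain ⟨σ, hσ⟩ := A.toLinearMap.rangeRestrict.exists_rightInverse_of_surjective
    (LinearMap.range_rangeRestrict _)
  obtain ⟨P, hP⟩ := LinearMap.exists_extend (B.toLinearMap.comp σ)
  refine ⟨LinearMap.toContinuousLinearMap P, fun v => ?_⟩
  have h1 := LinearMap.congr_fun hP (A.toLinearMap.rangeRestrict v)
  have h2 : A (σ (A.toLinearMap.rangeRestrict v)) = A v :=
    congrArg Subtype.val (LinearMap.congr_fun hσ (A.toLinearMap.rangeRestrict v))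
  have h3 : B (σ (A.toLinearMap.rangeRestrict v) - v) = 0 := h _ (by rw [map_sub, h2, sub_self])
  rw [map_sub, sub_eq_zero] at h3
  exact h1.trans h3

/-- At a point where one of the partial derivatives is missing, its value can be chosen so that the
chain rule holds along the graph of a given linear map. -/
theorem exists_partial_derivatives_at [FiniteDimensional ℝ E] (f : E → Y → F) (u : E) (y : Y)
    (A : Y →L[ℝ] E) :
    ∃ (p : E →L[ℝ] F) (q : Y →L[ℝ] F),
      (DifferentiableAt ℝ (fun u' => f u' y) u → p = fderiv ℝ (fun u' => f u' y) u) ∧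
      (DifferentiableAt ℝ (fun y' => f u y') y → q = fderiv ℝ (fun y' => f u y') y) ∧
      (¬(DifferentiableAt ℝ (fun u' => f u' y) u ∧ DifferentiableAt ℝ (fun y' => f u y') y) →
        ∀ d : Y →L[ℝ] F,
          (∀ δ, HasLineDerivAt ℝ (fun p : E × Y => f p.1 p.2) (d δ) (u, y) (A δ, δ)) →
          d = p.comp A + q) := by
  by_cases hd : ∃ d : Y →L[ℝ] F,
    ∀ δ, HasLineDerivAt ℝ (fun p : E × Y => f p.1 p.2) (d δ) (u, y) (A δ, δ)
  swap
  · exact ⟨_, _, fun _ => rfl, fun _ => rfl, fun _ d h => (hd ⟨d, h⟩).elim⟩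
  obtain ⟨d, hd⟩ := hd
  have huniq : ∀ d' : Y →L[ℝ] F,
      (∀ δ, HasLineDerivAt ℝ (fun p : E × Y => f p.1 p.2) (d' δ) (u, y) (A δ, δ)) → d' = d :=
    fun d' h => ContinuousLinearMap.ext fun δ => (h δ).unique (hd δ)
  by_cases hy : DifferentiableAt ℝ (fun y' => f u y') y
  · by_cases hu : DifferentiableAt ℝ (fun u' => f u' y) u
    · exact ⟨_, _, fun _ => rfl, fun _ => rfl, fun h => (h ⟨hu, hy⟩).elim⟩
    -- Where `A v = 0` the direction is `(0, v)`, so `d v` is the partial derivative in `y` and the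
    -- difference vanishes on the kernel of `A`.
    · obtain ⟨P, hP⟩ := exists_comp_eq_of_forall_eq_zero A
        (d - fderiv ℝ (fun y' => f u y') y) (fun v hv => by
          have h1 := hd v
          have h2 : HasDerivAt (fun t : ℝ => f u (y + t • v)) _ 0 :=
            hy.hasFDerivAt.hasLineDerivAt v
          rw [hv] at h1
          have h3 : HasDerivAt (fun t : ℝ => f u (y + t • v)) (d v) 0 := by
            simpa [HasLineDerivAt] using h1
          rw [sub_apply, h3.unique h2, sub_self])
      refine ⟨P, _, fun h => (hu h).elim, fun _ => rfl, fun _ d' hd' => ?_⟩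
      ext v
      rw [huniq d' hd', add_apply, ContinuousLinearMap.comp_apply, hP, sub_apply, sub_add_cancel]
  · refine ⟨fderiv ℝ (fun u' => f u' y) u, d - (fderiv ℝ (fun u' => f u' y) u).comp A,
      fun _ => rfl, fun h => (hy h).elim, fun _ d' hd' => ?_⟩
    rw [huniq d' hd', add_sub_cancel]

/-- For a Lipschitz map `f` and countably many Lipschitz maps `g ℓ` there are versions of the
partial Jacobians of `f` for which the chain rule holds along all the graphs of the `g ℓ`. -/
theorem LipschitzWith.exists_jacobians_chain_rule [FiniteDimensional ℝ E] [MeasureSpace E]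
    [BorelSpace E] [(volume : Measure E).IsAddHaarMeasure] [FiniteDimensional ℝ Y] [MeasureSpace Y]
    [BorelSpace Y] [(volume : Measure Y).IsAddHaarMeasure] [FiniteDimensional ℝ F] {C : NNReal}
    {f : E → Y → F} (hf : LipschitzWith C fun p : E × Y => f p.1 p.2) {g : ℕ → Y → E}
    (hg : ∀ ℓ, ∃ K, LipschitzWith K (g ℓ)) :
    ∃ (Ju : E → Y → E →L[ℝ] F) (Jy : E → Y → Y →L[ℝ] F),
      IsJacobianFst f Ju ∧ IsJacobianSnd f Jy ∧
      ∀ᵐ y : Y, ∀ (ℓ : ℕ) (δ : Y),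
        fderiv ℝ (fun z => f (g ℓ z) z) y δ
          = Ju (g ℓ y) y (fderiv ℝ (g ℓ) y δ) + Jy (g ℓ y) y δ ∧
        HasLineDerivAt ℝ (fun p : E × Y => f p.1 p.2)
          (Ju (g ℓ y) y (fderiv ℝ (g ℓ) y δ) + Jy (g ℓ y) y δ)
          (g ℓ y, y) (fderiv ℝ (g ℓ) y δ, δ) := by
  classical
  let A : E → Y → Y →L[ℝ] E := fun u y =>
    if h : ∃ ℓ, g ℓ y = u then fderiv ℝ (g h.choose) y else 0
  choose Ju Jy hJu hJy hJ using fun u y => exists_partial_derivatives_at f u y (A u y)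
  have hfst : ∀ y, LipschitzWith C fun u => f u y := fun y => by
    have := hf.comp (LipschitzWith.prodMk_right y)
    rwa [mul_one] at this
  have hsnd : ∀ u, LipschitzWith C fun y => f u y := fun u => by
    have := hf.comp (LipschitzWith.prodMk_left u)
    rwa [mul_one] at this
  refine ⟨Ju, Jy, fun y => ⟨(hfst y).hasWeakJacobian ?_, fun u => hJu u y⟩,
    fun u => ⟨(hsnd u).hasWeakJacobian ?_, fun y => hJy u y⟩, ?_⟩
  · filter_upwards [(hfst y).ae_differentiableAt (μ := volume)] with u hu using hJu u y hu
  · filter_upwards [(hsnd u).ae_differentiableAt (μ := volume)] with y hy using hJy u y hy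
  have hcomp : ∀ ℓ, ∀ᵐ y : Y, DifferentiableAt ℝ (fun z => f (g ℓ z) z) y := fun ℓ => by
    obtain ⟨K, hK⟩ := hg ℓ
    exact (hf.comp (hK.prodMk LipschitzWith.id)).ae_differentiableAt
  have hdiff : ∀ ℓ, ∀ᵐ y : Y, DifferentiableAt ℝ (g ℓ) y := fun ℓ => by
    obtain ⟨K, hK⟩ := hg ℓ
    exact hK.ae_differentiableAt
  filter_upwards [ae_all_iff.2 hcomp, ae_all_iff.2 hdiff,
    ae_all_iff.2 fun ℓ => ae_fderiv_comp_graph_eq volume f (g ℓ),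
    ae_all_iff.2 fun ℓ => ae_all_iff.2 fun m => ae_fderiv_eq_of_eq volume (g ℓ) (g m)]
    with y hc hd hchain heq ℓ δ
  have hline := hasLineDerivAt_graph hf (hd ℓ).hasFDerivAt (hc ℓ).hasFDerivAt
  have hA : A (g ℓ y) y = fderiv ℝ (g ℓ) y := by
    have h : ∃ m, g m y = g ℓ y := ⟨ℓ, rfl⟩
    simp only [A, dif_pos h]
    -- The picked graph meets that of `g ℓ` here, so outside a null set their derivatives coincide.
    exact heq _ _ h.choose_spec (hd _) (hd _)
  have key : fderiv ℝ (fun z => f (g ℓ z) z) y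
      = (Ju (g ℓ y) y).comp (fderiv ℝ (g ℓ) y) + Jy (g ℓ y) y := by
    by_cases hboth : DifferentiableAt ℝ (fun u' => f u' y) (g ℓ y) ∧
        DifferentiableAt ℝ (fun y' => f (g ℓ y) y') y
    · rw [hJu _ _ hboth.1, hJy _ _ hboth.2]
      exact hchain ℓ _ _ _ _ hboth.1.hasFDerivAt hboth.2.hasFDerivAt (hd ℓ).hasFDerivAt
        (hc ℓ).hasFDerivAt
    · have := hJ _ _ hboth (fderiv ℝ (fun z => f (g ℓ z) z) y)
      rw [hA] at this
      exact this hline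
  have hkey := DFunLike.congr_fun key δ
  refine ⟨hkey, ?_⟩
  have := hline δ
  rw [hkey] at this
  exact this

end Graph

/-! Lipschitz continuity of the primal-dual iteration -/

noncomputable section

namespace CPData

variable {X U Y Θ : Type*} [NormedAddCommGroup X] [InnerProductSpace ℝ X]
  [NormedAddCommGroup U] [InnerProductSpace ℝ U]

theorem lipschitzWith_proxH_fst [FiniteDimensional ℝ X] (D : CPData X U Y Θ) (hξ : 0 < D.ξ) {θ : Θ} {y : Y}
    (hH : ProperClosedConvex fun x => D.H x y θ) : LipschitzWith 1 fun x => D.proxH x y θ :=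
  (hH.const_mul hξ).lipschitzWith_prox

theorem lipschitzWith_proxGstar_fst [FiniteDimensional ℝ U] (D : CPData X U Y Θ) (hτ : 0 < D.τ) {θ : Θ} {y : Y}
    (hG : ProperClosedConvex fun u => D.G u y θ) : LipschitzWith 1 fun u => D.proxGstar u y θ :=
  (hG.conjugate.const_mul hτ).lipschitzWith_prox

variable [FiniteDimensional ℝ X] [FiniteDimensional ℝ U] [NormedAddCommGroup Y]

/-- `Prox_{τ G*}` is Lipschitz in `(u, y)` when `ψ` is uniformly Lipschitz in `y`. -/
theorem exists_lipschitzWith_proxGstar (D : CPData X U Y Θ) (hτ : 0 < D.τ) {θ : Θ}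
    (hG : ∀ y, ProperClosedConvex fun u => D.G u y θ)
    (hψ : ∃ L, ∀ a, LipschitzWith L fun y => D.ψ a y θ) :
    ∃ C, LipschitzWith C fun p : U × Y => D.proxGstar p.1 p.2 θ := by
  obtain ⟨L, hL⟩ := hψ
  have hsnd : ∀ u : U, LipschitzWith (1 * (1 * L)) fun y => D.proxGstar u y θ := fun u => by
    -- At the state `(0, 0, u)` the dual component of `ψ` is exactly the proximity operator at `u`.
    have h := LipschitzWith.prod_snd.comp (LipschitzWith.prod_snd.comp (hL (0, 0, u)))
    simpa [Function.comp_def, ψ] using h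
  exact ⟨_, LipschitzWith.uncurry (fun y => D.lipschitzWith_proxGstar_fst hτ (hG y)) hsnd⟩

/-- `Prox_{ξ H}` is Lipschitz in `(x, y)` when `ψ` is uniformly Lipschitz in `y`. -/
theorem exists_lipschitzWith_proxH (D : CPData X U Y Θ) (hτ : 0 < D.τ) (hξ : 0 < D.ξ) {θ : Θ}
    (hH : ∀ y, ProperClosedConvex fun x => D.H x y θ)
    (hG : ∀ y, ProperClosedConvex fun u => D.G u y θ)
    (hψ : ∃ L, ∀ a, LipschitzWith L fun y => D.ψ a y θ) :
    ∃ C, LipschitzWith C fun p : X × Y => D.proxH p.1 p.2 θ := by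
  obtain ⟨C, hC⟩ := D.exists_lipschitzWith_proxGstar hτ hG hψ
  obtain ⟨L, hL⟩ := hψ
  let T : U →L[ℝ] X := D.ξ • LinearMap.toContinuousLinearMap (LinearMap.adjoint D.K)
  have hsnd : ∀ x : X, LipschitzWith (L + ‖T‖₊ * C) fun y => D.proxH x y θ := fun x => by
    refine LipschitzWith.of_dist_le_mul fun y y' => ?_
    let w : Y → U := fun y => D.proxGstar 0 y θ
    -- The state `x + T (w y)` cancels the dual shift at the parameter `y`; at `y'` a shift `T (w y)
    -- - T (w y')` remains, bounded in `h2` by nonexpansiveness. The state varies with `y`, so `L`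
    -- must not depend on it.
    have h1 : dist (D.proxH x y θ) (D.proxH (x + T (w y) - T (w y')) y' θ) ≤ L * dist y y' := by
      have h := (LipschitzWith.prod_fst.comp (hL (x + T (w y), 0, 0))).dist_le_mul y y'
      simpa [ψ, w, T] using h
    have h2 : dist (D.proxH (x + T (w y) - T (w y')) y' θ) (D.proxH x y' θ)
        ≤ ‖T‖ * (C * dist y y') := by
      refine ((D.lipschitzWith_proxH_fst hξ (hH y')).dist_le_mul _ _).trans ?_
      have h3 : dist (w y) (w y') ≤ C * dist y y' := by
        have := hC.dist_le_mul (0, y) (0, y')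
        rwa [Prod.dist_eq, dist_self, max_eq_right dist_nonneg] at this
      rw [NNReal.coe_one, one_mul, dist_eq_norm, add_sub_assoc, add_sub_cancel_left, ← map_sub]
      refine (T.le_opNorm _).trans ?_
      rw [← dist_eq_norm]
      gcongr
    refine (dist_triangle _ _ _).trans ((add_le_add h1 h2).trans_eq ?_)
    push_cast
    ring
  exact ⟨_, LipschitzWith.uncurry (fun y => D.lipschitzWith_proxH_fst hξ (hH y)) hsnd⟩

/-- `U = u + τ K x̃` as a continuous linear function of the state. -/
def argUCLM (D : CPData X U Y Θ) : X × X × U →L[ℝ] U :=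
  let pr := ContinuousLinearMap.snd ℝ X (X × U)
  (ContinuousLinearMap.snd ℝ X U).comp pr +
    D.τ • (LinearMap.toContinuousLinearMap D.K).comp ((ContinuousLinearMap.fst ℝ X U).comp pr)

/-- `X = x - ξ K* u'` as a continuous linear function of `(x, u')`. -/
def argXCLM (D : CPData X U Y Θ) : X × U →L[ℝ] X :=
  ContinuousLinearMap.fst ℝ X U -
    D.ξ • (LinearMap.toContinuousLinearMap (LinearMap.adjoint D.K)).comp
      (ContinuousLinearMap.snd ℝ X U)

/-- `x' + ζ (x' - x)` as a continuous linear function of `(x', x)`. -/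
def relaxCLM (D : CPData X U Y Θ) : X × X →L[ℝ] X :=
  ContinuousLinearMap.fst ℝ X X +
    D.ζ • (ContinuousLinearMap.fst ℝ X X - ContinuousLinearMap.snd ℝ X X)

/-- By unfolding, `ψ` is a composition of the two proximity operators with the continuous linear
maps above, which also serve to differentiate the arguments `U`, `X` and the relaxation step. -/
theorem exists_lipschitzWith_ψ (D : CPData X U Y Θ) {θ : Θ}
    (hGL : ∃ C, LipschitzWith C fun p : U × Y => D.proxGstar p.1 p.2 θ)
    (hHL : ∃ C, LipschitzWith C fun p : X × Y => D.proxH p.1 p.2 θ) :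
    ∃ C, LipschitzWith C fun p : (X × X × U) × Y => D.ψ p.1 p.2 θ := by
  obtain ⟨C, hC⟩ := hGL
  obtain ⟨C', hC'⟩ := hHL
  have hy : LipschitzWith 1 fun p : (X × X × U) × Y => p.2 := LipschitzWith.prod_snd
  have ha : LipschitzWith 1 fun p : (X × X × U) × Y => p.1 := LipschitzWith.prod_fst
  have hx₀ : LipschitzWith (1 * 1) fun p : (X × X × U) × Y => p.1.1 :=
    LipschitzWith.prod_fst.comp ha
  obtain ⟨cU, hU⟩ : ∃ c, LipschitzWith c D.argUCLM := ⟨_, D.argUCLM.lipschitz⟩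
  obtain ⟨cX, hX⟩ : ∃ c, LipschitzWith c D.argXCLM := ⟨_, D.argXCLM.lipschitz⟩
  obtain ⟨cR, hR⟩ : ∃ c, LipschitzWith c D.relaxCLM := ⟨_, D.relaxCLM.lipschitz⟩
  have hu := hC.comp ((hU.comp ha).prodMk hy)
  have hx := hC'.comp ((hX.comp (hx₀.prodMk hu)).prodMk hy)
  have h := hx.prodMk ((hR.comp (hx.prodMk hx₀)).prodMk hu)
  exact ⟨_, h⟩

theorem exists_lipschitzWith_a (D : CPData X U Y Θ) {θ : Θ}
    (hψL : ∃ C, LipschitzWith C fun p : (X × X × U) × Y => D.ψ p.1 p.2 θ)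
    {a₀ : Y → Θ → X × X × U} (ha₀ : ∃ C, LipschitzWith C fun y => a₀ y θ) (ℓ : ℕ) :
    ∃ C, LipschitzWith C fun y => D.a a₀ ℓ y θ := by
  induction ℓ with
  | zero => exact ha₀
  | succ ℓ ih =>
    obtain ⟨C, hC⟩ := hψL
    obtain ⟨L, hL⟩ := ih
    have h := hC.comp (hL.prodMk LipschitzWith.id)
    exact ⟨_, h⟩

end CPData

end

/-! ### Weak derivatives of the iterates -/

theorem mainTheorem10 {X U Y Θ : Type*}
    [NormedAddCommGroup X] [InnerProductSpace ℝ X] [FiniteDimensional ℝ X]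
    [MeasurableSpace X] [BorelSpace X]
    [NormedAddCommGroup U] [InnerProductSpace ℝ U] [FiniteDimensional ℝ U]
    [MeasurableSpace U] [BorelSpace U]
    [NormedAddCommGroup Y] [InnerProductSpace ℝ Y] [FiniteDimensional ℝ Y]
    [MeasurableSpace Y] [BorelSpace Y]
    (D : CPData X U Y Θ) (hτ : 0 < D.τ) (hξ : 0 < D.ξ) (θ : Θ)
    (hH : ∀ y, ProperClosedConvex fun x => D.H x y θ)
    (hG : ∀ y, ProperClosedConvex fun u => D.G u y θ)
    (hψ : ∃ L, ∀ a, LipschitzWith L fun y => D.ψ a y θ)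
    (a₀ : Y → Θ → X × X × U) (ha₀ : ∃ C, LipschitzWith C fun y => a₀ y θ) :
    (∀ ℓ, WeaklyDifferentiable (fun y => D.a a₀ ℓ y θ) ∧
      WeaklyDifferentiable (fun y => D.u a₀ ℓ y θ) ∧
      WeaklyDifferentiable (fun y => D.x a₀ ℓ y θ) ∧
      WeaklyDifferentiable (fun y => D.xt a₀ ℓ y θ)) ∧
    ∃ (Gu : U → Y → U →L[ℝ] U) (Gy : U → Y → Y →L[ℝ] U)
      (Hx : X → Y → X →L[ℝ] X) (Hy : X → Y → Y →L[ℝ] X)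
      (Ψa : X × X × U → Y → X × X × U →L[ℝ] X × X × U)
      (Ψy : X × X × U → Y → Y →L[ℝ] X × X × U),
      IsJacobianFst (fun u y => D.proxGstar u y θ) Gu ∧
      IsJacobianSnd (fun u y => D.proxGstar u y θ) Gy ∧
      IsJacobianFst (fun x y => D.proxH x y θ) Hx ∧
      IsJacobianSnd (fun x y => D.proxH x y θ) Hy ∧
      IsJacobianFst (fun a y => D.ψ a y θ) Ψa ∧
      IsJacobianSnd (fun a y => D.ψ a y θ) Ψy ∧
      ∀ (Da : ℕ → Y → Y →L[ℝ] X × X × U) (Du : ℕ → Y → Y →L[ℝ] U)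
        (Dx Dxt : ℕ → Y → Y →L[ℝ] X),
        (∀ ℓ, HasWeakJacobian (fun y => D.a a₀ ℓ y θ) (Da ℓ)) →
        (∀ ℓ, HasWeakJacobian (fun y => D.u a₀ ℓ y θ) (Du ℓ)) →
        (∀ ℓ, HasWeakJacobian (fun y => D.x a₀ ℓ y θ) (Dx ℓ)) →
        (∀ ℓ, HasWeakJacobian (fun y => D.xt a₀ ℓ y θ) (Dxt ℓ)) →
        ∀ᵐ y : Y, ∀ (ℓ : ℕ) (δ : Y),
          let DU : U := Du ℓ y δ + D.τ • D.K (Dxt ℓ y δ)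
          let DX : X := Dx ℓ y δ - D.ξ • LinearMap.adjoint D.K (Du (ℓ + 1) y δ)
          -- the general recursion for the state and its read-out
          Da ℓ y δ = (Dx ℓ y δ, Dxt ℓ y δ, Du ℓ y δ) ∧
          Dx ℓ y δ = fderiv ℝ CPData.γ (D.a a₀ ℓ y θ) (Da ℓ y δ) ∧
          Da (ℓ + 1) y δ = Ψa (D.a a₀ ℓ y θ) y (Da ℓ y δ) + Ψy (D.a a₀ ℓ y θ) y δ ∧
          -- the explicit recursion
          Du (ℓ + 1) y δ = Gu (D.argU a₀ ℓ y θ) y DU + Gy (D.argU a₀ ℓ y θ) y δ ∧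
          Dx (ℓ + 1) y δ = Hx (D.argX a₀ ℓ y θ) y DX + Hy (D.argX a₀ ℓ y θ) y δ ∧
          Dxt (ℓ + 1) y δ = Dx (ℓ + 1) y δ + D.ζ • (Dx (ℓ + 1) y δ - Dx ℓ y δ) ∧
          -- the Jacobians act as derivatives along the directions to which they are applied
          HasLineDerivAt ℝ (fun p : U × Y => D.proxGstar p.1 p.2 θ)
            (Gu (D.argU a₀ ℓ y θ) y DU + Gy (D.argU a₀ ℓ y θ) y δ)
            (D.argU a₀ ℓ y θ, y) (DU, δ) ∧
          HasLineDerivAt ℝ (fun p : X × Y => D.proxH p.1 p.2 θ)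
            (Hx (D.argX a₀ ℓ y θ) y DX + Hy (D.argX a₀ ℓ y θ) y δ)
            (D.argX a₀ ℓ y θ, y) (DX, δ) ∧
          HasLineDerivAt ℝ (fun p : (X × X × U) × Y => D.ψ p.1 p.2 θ)
            (Ψa (D.a a₀ ℓ y θ) y (Da ℓ y δ) + Ψy (D.a a₀ ℓ y θ) y δ)
            (D.a a₀ ℓ y θ, y) (Da ℓ y δ, δ) := by
  obtain ⟨CG, hCG⟩ := D.exists_lipschitzWith_proxGstar hτ hG hψ
  obtain ⟨CH, hCH⟩ := D.exists_lipschitzWith_proxH hτ hξ hH hG hψ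
  obtain ⟨Cψ, hCψ⟩ := D.exists_lipschitzWith_ψ ⟨CG, hCG⟩ ⟨CH, hCH⟩
  have ha := D.exists_lipschitzWith_a ⟨Cψ, hCψ⟩ ha₀
  choose La hLa using ha
  have hLx : ∀ ℓ, LipschitzWith (1 * La ℓ) fun y => D.x a₀ ℓ y θ :=
    fun ℓ => LipschitzWith.prod_fst.comp (hLa ℓ)
  have hLxt : ∀ ℓ, LipschitzWith (1 * (1 * La ℓ)) fun y => D.xt a₀ ℓ y θ :=
    fun ℓ => LipschitzWith.prod_fst.comp (LipschitzWith.prod_snd.comp (hLa ℓ))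
  have hLu : ∀ ℓ, LipschitzWith (1 * (1 * La ℓ)) fun y => D.u a₀ ℓ y θ :=
    fun ℓ => LipschitzWith.prod_snd.comp (LipschitzWith.prod_snd.comp (hLa ℓ))
  have hLU : ∀ ℓ, LipschitzWith (‖D.argUCLM‖₊ * La ℓ) fun y => D.argU a₀ ℓ y θ :=
    fun ℓ => D.argUCLM.lipschitz.comp (hLa ℓ)
  have hLX : ∀ ℓ, ∃ L, LipschitzWith L fun y => D.argX a₀ ℓ y θ :=
    fun ℓ => ⟨_, D.argXCLM.lipschitz.comp ((hLx ℓ).prodMk (hLu (ℓ + 1)))⟩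
  obtain ⟨Gu, Gy, hGu, hGy, hGc⟩ :=
    LipschitzWith.exists_jacobians_chain_rule (f := fun u y => D.proxGstar u y θ) hCG (g := fun ℓ y => D.argU a₀ ℓ y θ)
      fun ℓ => ⟨_, hLU ℓ⟩
  obtain ⟨Hx, Hy, hHx, hHy, hHc⟩ :=
    LipschitzWith.exists_jacobians_chain_rule (f := fun x y => D.proxH x y θ) hCH (g := fun ℓ y => D.argX a₀ ℓ y θ) hLX
  have : (volume : Measure (X × U)).IsAddHaarMeasure :=
    Measure.prod.instIsAddHaarMeasure volume volume
  have : (volume : Measure (X × X × U)).IsAddHaarMeasure :=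
    Measure.prod.instIsAddHaarMeasure volume volume
  obtain ⟨Ψa, Ψy, hΨa, hΨy, hΨc⟩ :=
    LipschitzWith.exists_jacobians_chain_rule (f := fun a y => D.ψ a y θ) hCψ (g := fun ℓ y => D.a a₀ ℓ y θ)
      fun ℓ => ⟨_, hLa ℓ⟩
  refine ⟨fun ℓ => ⟨(hLa ℓ).weaklyDifferentiable, (hLu ℓ).weaklyDifferentiable,
    (hLx ℓ).weaklyDifferentiable, (hLxt ℓ).weaklyDifferentiable⟩,
    Gu, Gy, Hx, Hy, Ψa, Ψy, hGu, hGy, hHx, hHy, hΨa, hΨy, ?_⟩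
  intro Da Du Dx Dxt hDa hDu hDx hDxt
  -- The partial Jacobians were built from classical derivatives of the iterates, so they suit any
  -- later choice of weak Jacobians; countability of `ℓ` leaves a single null set.
  filter_upwards [hGc, hHc, hΨc, ae_all_iff.2 fun ℓ => (hDa ℓ).ae_eq_fderiv (hLa ℓ),
    ae_all_iff.2 fun ℓ => (hDu ℓ).ae_eq_fderiv (hLu ℓ),
    ae_all_iff.2 fun ℓ => (hDx ℓ).ae_eq_fderiv (hLx ℓ),
    ae_all_iff.2 fun ℓ => (hDxt ℓ).ae_eq_fderiv (hLxt ℓ),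
    ae_all_iff.2 fun ℓ => (hLa ℓ).ae_differentiableAt (μ := volume)]
    with y hGc hHc hΨc hDa hDu hDx hDxt hd ℓ δ
  have hda := fun ℓ => (hd ℓ).hasFDerivAt
  have hdx : ∀ ℓ, HasFDerivAt (fun y => D.x a₀ ℓ y θ) _ y := fun ℓ => (hda ℓ).fst
  have hdxt : ∀ ℓ, HasFDerivAt (fun y => D.xt a₀ ℓ y θ) _ y := fun ℓ => (hda ℓ).snd.fst
  have hdu : ∀ ℓ, HasFDerivAt (fun y => D.u a₀ ℓ y θ) _ y := fun ℓ => (hda ℓ).snd.snd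
  have hdU : HasFDerivAt (fun y => D.argU a₀ ℓ y θ) _ y :=
    D.argUCLM.hasFDerivAt.comp y (hda ℓ)
  have hdX : HasFDerivAt (fun y => D.argX a₀ ℓ y θ) _ y :=
    D.argXCLM.hasFDerivAt.comp y ((hdx ℓ).prodMk (hdu (ℓ + 1)))
  have hDa' : Da ℓ y δ = (Dx ℓ y δ, Dxt ℓ y δ, Du ℓ y δ) := by
    rw [hDa, hDx, hDxt, hDu, (hdx ℓ).fderiv, (hdxt ℓ).fderiv, (hdu ℓ).fderiv]
    rfl
  have hU : fderiv ℝ (fun y => D.argU a₀ ℓ y θ) y δ = Du ℓ y δ + D.τ • D.K (Dxt ℓ y δ) := by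
    rw [hdU.fderiv, hDxt, hDu, (hdxt ℓ).fderiv, (hdu ℓ).fderiv]
    rfl
  have hX : fderiv ℝ (fun y => D.argX a₀ ℓ y θ) y δ
      = Dx ℓ y δ - D.ξ • LinearMap.adjoint D.K (Du (ℓ + 1) y δ) := by
    rw [hdX.fderiv, hDx, hDu, (hdx ℓ).fderiv, (hdu (ℓ + 1)).fderiv]
    rfl
  have hγ : fderiv ℝ (CPData.γ : X × X × U → X) (D.a a₀ ℓ y θ)
      = ContinuousLinearMap.fst ℝ X (X × U) := fderiv_fst
  obtain ⟨hG1, hG2⟩ := hGc ℓ δ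
  obtain ⟨hH1, hH2⟩ := hHc ℓ δ
  obtain ⟨hΨ1, hΨ2⟩ := hΨc ℓ δ
  rw [hU] at hG1 hG2
  rw [hX] at hH1 hH2
  rw [← hDa ℓ] at hΨ1 hΨ2
  refine ⟨hDa', ?_, ?_, ?_, ?_, ?_, hG2, hH2, hΨ2⟩
  · rw [hγ, hDa']
    rfl
  · rw [hDa (ℓ + 1)]
    exact hΨ1
  · rw [hDu (ℓ + 1)]
    exact hG1
  · rw [hDx (ℓ + 1)]
    exact hH1
  -- The relaxation step is linear in `(x (ℓ + 1), x ℓ)`, so the ordinary chain rule suffices.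
  · have h : HasFDerivAt (fun y => D.xt a₀ (ℓ + 1) y θ) _ y :=
      D.relaxCLM.hasFDerivAt.comp y ((hdx (ℓ + 1)).prodMk (hdx ℓ))
    rw [hDxt, hDx, hDx, h.fderiv, (hdx (ℓ + 1)).fderiv, (hdx ℓ).fderiv]
    rfl
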